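/- Let $G$ be a finitely presented group and let $\eta\colon\mathcal X\to G$ be any finite generating system (a map from a finite set whose image generates $G$). A character of $G$ is a homomorphism $\chi\colon G\to(\mathbb R,+)$; the character sphere is $S(G)=\{[\chi]\mid \chi\in\operatorname{Hom}(G,\mathbb R)\setminus\{0\}\}$, where $[\chi]$ is the ray $\{r\chi\mid r>0\}$, and $-[\chi]=[-\chi]$. Let $\Sigma^1(G)\subseteq S(G)$ be the set of those $[\chi]$ for which the full subgraph of the Cayley graph $\Gamma(G,\mathcal X)$ (with edges joining $g$ and $g\cdot\eta(x)$) on the vertex set $\{g\in G\mid\chi(g)\ge 0\}$ is connected. Then the following hold. (1) Let $\chi$ be a non-zero character of $G$ such that both $[\chi]$ and $-[\chi]$ lie outside $\Sigma^1(G)$, and let $N=\ker\chi$. Then $N$ has subgroups $S_-$, $S_+$ and $S_0\subseteq S_-\cap S_+$ such that the inclusions induce an isomorphism of the free product with amalgamation $S_-\star_{S_0}S_+$ onto $N$, the subgroup $S_0$ has infinite index both in $S_-$ and in $S_+$, and neither $S_-$ nor $S_+$ is finitely generated. Moreover, $N$ contains a non-abelian free subgroup. (2) If $G$ contains no non-abelian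 free subgroup, then $\Sigma^1(G)\cup-\Sigma^1(G)=S(G)$, where $-\Sigma^1(G)=\{-p\mid p\in\Sigma^1(G)\}$. In particular, $\Sigma^1(G)$ is non-empty unless the abelianization $G/G'$ is finite. -/

import Mathlib

universe u v

namespace SigmaInvariant

/-- Characters of `G`: homomorphisms from `G` to the additive group of the reals, with their
pointwise structure of a real vector space. -/
abbrev Character (G : Type u) [Group G] : Type u := Additive G →+ ℝ

/-- The kernel of a character, as a subgroup of `G`. -/
abbrev characterKer {G : Type u} [Group G] (χ : Character G) : Subgroup G :=
  (AddMonoidHom.toMultiplicativeRight χ).ker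

/-- The character sphere `S(G)`: the rays spanned by the non-zero characters, two of which are
equivalent when they are positive multiples of each other. -/
abbrev CharacterSphere (G : Type u) [Group G] : Type u := Module.Ray ℝ (Character G)

/-- The point `[χ]` of the character sphere. -/
noncomputable abbrev spherePoint {G : Type u} [Group G] (χ : Character G) (hχ : χ ≠ 0) :
    CharacterSphere G :=
  rayOfNeZero ℝ χ hχ

/-- `η` is a finite generating system of `G`. -/
structure IsFiniteGeneratingSystem {G : Type u} [Group G] {X : Type v} (η : X → G) : Prop where
  finite : Finite X
  generates : Subgroup.closure (Set.range η) = ⊤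

/-- The full subgraph `Γ_χ` of the Cayley graph of `G` with respect to `η` (with edges joining
`g` and `g * η x`) on the set of vertices `g` with `0 ≤ χ g`. -/
def halfCayleyGraph {G : Type u} [Group G] {X : Type v} (η : X → G) (χ : Character G) :
    SimpleGraph {g : G | 0 ≤ χ (Additive.ofMul g)} :=
  (SimpleGraph.mulCayley (Set.range η)).induce {g : G | 0 ≤ χ (Additive.ofMul g)}

/-- The invariant `Σ¹`, computed with the generating system `η`. -/
def sigmaOne {G : Type u} [Group G] {X : Type v} (η : X → G) : Set (CharacterSphere G) :=
  {p | ∃ (χ : Character G) (hχ : χ ≠ 0), spherePoint χ hχ = p ∧ (halfCayleyGraph η χ).Connected}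

/-- Characters in the same ray have the same half Cayley graph, so
membership in `sigmaOne η` may be tested on any representative. -/
theorem spherePoint_mem_sigmaOne {G : Type u} [Group G] {X : Type v} (η : X → G)
    (χ : Character G) (hχ : χ ≠ 0) :
    spherePoint χ hχ ∈ sigmaOne η ↔ (halfCayleyGraph η χ).Connected := by
  constructor
  · rintro ⟨ψ, hψ, he, hc⟩
    obtain ⟨r, hr, rfl⟩ := ((ray_eq_iff hψ hχ).1 he).exists_pos_left hψ hχ
    have hset : {g : G | 0 ≤ (r • ψ) (Additive.ofMul g)} = {g : G | 0 ≤ ψ (Additive.ofMul g)} := by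
      ext g
      simp [hr]
    unfold halfCayleyGraph at hc ⊢
    rw [hset]
    exact hc
  · intro h
    exact ⟨χ, hχ, rfl, h⟩

/-- The canonical homomorphism to `N` from the free product of a family of subgroups `A i` of `N`
amalgamated along their common subgroup `H`, induced by the inclusions. -/
def amalgamMap {ι : Type v} {N : Type u} [Group N] (H : Subgroup N) (A : ι → Subgroup N)
    (h : ∀ i, H ≤ A i) :
    Monoid.PushoutI (fun i => Subgroup.inclusion (h i)) →* N :=
  Monoid.PushoutI.lift (fun i => (A i).subtype) H.subtype (fun _ => rfl)

theorem amalgamMap_of {ι : Type v} {N : Type u} [Group N] (H : Subgroup N) (A : ι → Subgroup N)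
    (h : ∀ i, H ≤ A i) (i : ι) (x : A i) :
    amalgamMap H A h (Monoid.PushoutI.of (φ := fun i => Subgroup.inclusion (h i)) i x) = (x : N) :=
  Monoid.PushoutI.lift_of (φ := fun i => Subgroup.inclusion (h i)) _ _ _ x

theorem amalgamMap_base {ι : Type v} {N : Type u} [Group N] (H : Subgroup N) (A : ι → Subgroup N)
    (h : ∀ i, H ≤ A i) (x : H) :
    amalgamMap H A h (Monoid.PushoutI.base (fun i => Subgroup.inclusion (h i)) x) = (x : N) :=
  Monoid.PushoutI.lift_base (φ := fun i => Subgroup.inclusion (h i)) _ _ _ x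

/-- `N = Sm ⋆_{S0} Sp`: the subgroup `S0` is contained in `Sm` and in `Sp`, and the inclusions
induce an isomorphism from the free product with amalgamation onto `N`. -/
def IsFreeProductWithAmalgamation {N : Type u} [Group N] (S0 Sm Sp : Subgroup N) : Prop :=
  ∃ h : ∀ i : Bool, S0 ≤ cond i Sp Sm,
    Function.Bijective (amalgamMap S0 (fun i : Bool => cond i Sp Sm) h)

/-- `N` contains a non-abelian free subgroup. -/
def HasNonabelianFreeSubgroup (N : Type u) [Group N] : Prop :=
  ∃ F : Subgroup N, IsFreeGroup F ∧ ∃ a b : F, a * b ≠ b * a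

end SigmaInvariant

namespace SigmaInvariant

/-! ### Paths in the Cayley graph with prescribed heights, and connectivity of half spaces. -/

section HeightConnected

variable {H : Type*} [Group H] {Y : Type*}

/-! Let `N` be the kernel of `χ`. It acts freely on the simply connected Cayley complex of a finite
presentation, so it is the fundamental group of the quotient. Choose `c` so large that every edge
and every relator loop lies in one of the half spaces `{χ ≤ c}` and `{-c ≤ χ}`. A van Kampen
argument then exhibits `N` as the amalgam of the subgroups of elements reachable from `1` in the two
halves, over those reachable in the strip.

The argument is made algebraic in `halfAmalgamMap_bijective`. With `P` the amalgam, each generator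
is sent to the function on `G ⧸ N` that lifts its edge loops to `P`, which gives a homomorphism from
the free group to `(G ⧸ N → P) ⋊ G`. A relator contributes a value lying in one factor of `P`, where
`P → N` is injective, so the homomorphism descends to `G`. Restricted to `N` and evaluated at the
coset `1`, it inverts `P → N`.

The hypothesis on `Σ¹` enters through `not_halfSubgroup_le`: no half is contained in the opposite
half, however wide the latter is. Each half exhausts `N` as its width grows. If a half were finitely
generated, or contained the strip with finite index, it would lie in some widened opposite half.
Non-containment holds because conjugation by an element of large height moves any given kernel
element into the upper half. A containment would therefore spread to all of `N`, and that makes a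
half Cayley graph connected.

The free subgroup comes from ping-pong on reduced words of the amalgam. Part (2) follows by applying
(1) to a point outside the union; an infinite abelianization supplies a non-zero character. -/

theorem char_mul (χ : Character H) (a b : H) :
    χ (.ofMul (a * b)) = χ (.ofMul a) + χ (.ofMul b) := map_add χ _ _

theorem char_inv (χ : Character H) (a : H) : χ (.ofMul a⁻¹) = -χ (.ofMul a) := map_neg χ _

theorem char_one (χ : Character H) : χ (.ofMul (1 : H)) = 0 := map_zero χ

/-- `g` and `h` are joined by an edge path of the Cayley graph of `H` with respect to `y`,
all of whose vertices have `χ`-value in `I` (or `g = h`). -/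
def HeightConnected (y : Y → H) (χ : Character H) (I : Set ℝ) : H → H → Prop :=
  Relation.EqvGen fun g h => χ (.ofMul g) ∈ I ∧ χ (.ofMul h) ∈ I ∧ ∃ i, h = g * y i

namespace HeightConnected

variable {y : Y → H} {χ : Character H} {I J : Set ℝ} {g h k : H}

theorem refl (g : H) : HeightConnected y χ I g g := Relation.EqvGen.refl g

theorem symm (hc : HeightConnected y χ I g h) : HeightConnected y χ I h g :=
  Relation.EqvGen.symm _ _ hc

theorem trans (h₁ : HeightConnected y χ I g h) (h₂ : HeightConnected y χ I h k) :
    HeightConnected y χ I g k :=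
  Relation.EqvGen.trans _ _ _ h₁ h₂

theorem translate (hc : HeightConnected y χ I g h) (k : H)
    (hIJ : ∀ t ∈ I, χ (.ofMul k) + t ∈ J) : HeightConnected y χ J (k * g) (k * h) := by
  induction hc with
  | rel a b hab =>
    obtain ⟨ha, hb, i, rfl⟩ := hab
    refine Relation.EqvGen.rel _ _ ⟨?_, ?_, i, (mul_assoc _ _ _).symm⟩
    · rw [char_mul]; exact hIJ _ ha
    · rw [char_mul χ k]; exact hIJ _ hb
  | refl a => exact refl _
  | symm a b _ ih => exact ih.symm
  | trans a b c _ _ ih₁ ih₂ => exact ih₁.trans ih₂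

theorem mono (hc : HeightConnected y χ I g h) (hIJ : I ⊆ J) : HeightConnected y χ J g h := by
  simpa using hc.translate 1 (J := J) (fun t ht => by simpa using hIJ ht)

theorem map {K : Type*} [Group K] {f : H →* K} {ψ : Character K}
    (hc : HeightConnected y (ψ.comp (MonoidHom.toAdditive f)) I g h) :
    HeightConnected (f ∘ y) ψ I (f g) (f h) := by
  induction hc with
  | rel a b hab =>
    obtain ⟨ha, hb, i, rfl⟩ := hab
    exact Relation.EqvGen.rel _ _ ⟨ha, hb, i, map_mul f _ _⟩
  | refl a => exact refl _
  | symm a b _ ih => exact ih.symm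
  | trans a b c _ _ ih₁ ih₂ => exact ih₁.trans ih₂

theorem neg (hc : HeightConnected y χ I g h) (hIJ : ∀ t ∈ I, -t ∈ J) :
    HeightConnected y (-χ) J g h := by
  induction hc with
  | rel a b hab => exact Relation.EqvGen.rel _ _ ⟨hIJ _ hab.1, hIJ _ hab.2.1, hab.2.2⟩
  | refl a => exact refl _
  | symm a b _ ih => exact ih.symm
  | trans a b c _ _ ih₁ ih₂ => exact ih₁.trans ih₂

theorem step {x : H} (hx : x ∈ Set.range y ∨ x⁻¹ ∈ Set.range y)
    (hg : χ (.ofMul g) ∈ I) (hgx : χ (.ofMul (g * x)) ∈ I) :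
    HeightConnected y χ I g (g * x) := by
  rcases hx with ⟨i, rfl⟩ | ⟨i, hi⟩
  · exact Relation.EqvGen.rel _ _ ⟨hg, hgx, i, rfl⟩
  · exact symm (Relation.EqvGen.rel _ _ ⟨hgx, hg, i, by rw [hi]; group⟩)

end HeightConnected

open HeightConnected

variable {y : Y → H} (hy : Subgroup.closure (Set.range y) = ⊤) (χ : Character H)

include hy in
/-- Every element is represented by a path whose heights stay within a bounded distance of the
height of its origin. -/
theorem exists_heightConnected_mul (k : H) :
    ∃ M : ℝ, 0 ≤ M ∧ ∀ g, HeightConnected y χ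
      (Set.Icc (χ (.ofMul g) - M) (χ (.ofMul g) + M)) g (g * k) := by
  have hk : k ∈ Subgroup.closure (Set.range y) := hy ▸ Subgroup.mem_top k
  induction hk using Subgroup.closure_induction with
  | mem x hx =>
    refine ⟨|χ (.ofMul x)|, abs_nonneg _, fun g => step (Or.inl hx) ?_ ?_⟩
    · constructor <;> linarith [abs_nonneg (χ (.ofMul x))]
    · rw [char_mul]
      constructor <;> linarith [le_abs_self (χ (.ofMul x)), neg_abs_le (χ (.ofMul x))]
  | one => exact ⟨0, le_rfl, fun g => by rw [mul_one]; exact refl g⟩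
  | mul a b _ _ iha ihb =>
    obtain ⟨M, hM, hMa⟩ := iha
    obtain ⟨M', hM', hMb⟩ := ihb
    refine ⟨M + |χ (.ofMul a)| + M', by positivity, fun g => ?_⟩
    have h1 := abs_nonneg (χ (.ofMul a))
    have h2 := hMb (g * a)
    rw [char_mul, mul_assoc] at h2
    refine ((hMa g).mono (Set.Icc_subset_Icc ?_ ?_)).trans (h2.mono (Set.Icc_subset_Icc ?_ ?_))
    all_goals linarith [le_abs_self (χ (.ofMul a)), neg_abs_le (χ (.ofMul a))]
  | inv a _ iha =>
    obtain ⟨M, hM, hMa⟩ := iha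
    refine ⟨M + |χ (.ofMul a)|, by positivity, fun g => ?_⟩
    have h2 := (hMa (g * a⁻¹)).symm
    rw [char_mul, char_inv, inv_mul_cancel_right] at h2
    refine h2.mono (Set.Icc_subset_Icc ?_ ?_)
    all_goals linarith [le_abs_self (χ (.ofMul a)), neg_abs_le (χ (.ofMul a))]

include hy in
/-- Passing to another generating system changes connectivity only by a bounded thickening. -/
theorem exists_heightConnected_change {Z : Type*} [Finite Z] (z : Z → H) :
    ∃ M : ℝ, 0 ≤ M ∧ ∀ (I J : Set ℝ), (∀ s ∈ I, Set.Icc (s - M) (s + M) ⊆ J) →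
      ∀ g h, HeightConnected z χ I g h → HeightConnected y χ J g h := by
  choose M hM hMc using fun i => exists_heightConnected_mul hy χ (z i)
  obtain ⟨B, hB⟩ := (Set.finite_range M).bddAbove
  have hB' : ∀ i, M i ≤ B := fun i => hB ⟨i, rfl⟩
  refine ⟨max B 0, le_max_right _ _, fun I J hIJ g h hc => ?_⟩
  induction hc with
  | rel a b hab =>
    obtain ⟨ha, hb, i, rfl⟩ := hab
    refine ((hMc i a).mono ?_)
    refine (Set.Icc_subset_Icc ?_ ?_).trans (hIJ _ ha)
    all_goals linarith [hB' i, le_max_left B 0]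
  | refl a => exact refl _
  | symm a b _ ih => exact ih.symm
  | trans a b c _ _ ih₁ ih₂ => exact ih₁.trans ih₂

/-- Reordering the letters does not change the final height. At height at most `0` a letter of
positive height is used, above `0` one of non-positive height, so no step leaves the hull. Once no
such letter remains, the rest of the word moves monotonically towards `q`. -/
theorem exists_heightConnected_of_list {c : ℝ} (hc : ∀ i, |χ (.ofMul (y i))| ≤ c) (q : ℝ) (n : ℕ)
    (L : List H) (hn : L.length = n) (hL : ∀ x ∈ L, x ∈ Set.range y ∨ x⁻¹ ∈ Set.range y)
    (g : H) (hg : χ (.ofMul g) ∈ Set.Icc (min (-c) q) (max c q))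
    (hq : χ (.ofMul g) + (L.map fun x => χ (.ofMul x)).sum = q) :
    ∃ h, χ (.ofMul h) = q ∧ HeightConnected y χ (Set.Icc (min (-c) q) (max c q)) g h := by
  classical
  induction n generalizing L g with
  | zero =>
    obtain rfl := List.length_eq_zero_iff.mp hn
    exact ⟨g, by simpa using hq, refl g⟩
  | succ n ih =>
    have hbound : ∀ x ∈ L, |χ (.ofMul x)| ≤ c := by
      intro x hx
      rcases hL x hx with ⟨i, rfl⟩ | ⟨i, hi⟩
      · exact hc i
      · have := hc i
        rwa [hi, char_inv, abs_neg] at this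
    have key : ∀ x ∈ L, χ (.ofMul (g * x)) ∈ Set.Icc (min (-c) q) (max c q) →
        ∃ h, χ (.ofMul h) = q ∧ HeightConnected y χ (Set.Icc (min (-c) q) (max c q)) g h := by
      intro x hx hgx
      have hp := List.perm_cons_erase hx
      obtain ⟨h, hh, hc'⟩ := ih (L.erase x) (by rw [List.length_erase_of_mem hx, hn]; rfl)
        (fun z hz => hL z (List.mem_of_mem_erase hz)) (g * x) hgx
        (by
          have := (hp.map fun x => χ (.ofMul x)).sum_eq
          rw [List.map_cons, List.sum_cons] at this
          rw [char_mul]; linarith)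
      exact ⟨h, hh, (step (hL x hx) hg hgx).trans hc'⟩
    have hx0 : ∃ x, x ∈ L := List.exists_mem_of_length_pos (by omega)
    obtain ⟨x₀, hx₀⟩ := hx0
    have hsum : (L.map fun x => χ (.ofMul x)).sum =
        χ (.ofMul x₀) + ((L.erase x₀).map fun x => χ (.ofMul x)).sum := by
      rw [((List.perm_cons_erase hx₀).map fun x => χ (.ofMul x)).sum_eq]; simp
    rcases le_or_gt (χ (.ofMul g)) 0 with h0 | h0
    · by_cases hpos : ∃ x ∈ L, 0 < χ (.ofMul x)
      · obtain ⟨x, hx, hx'⟩ := hpos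
        refine key x hx ?_
        have := (abs_le.mp (hbound x hx)).2
        rw [char_mul]
        exact ⟨by linarith [hg.1], le_max_of_le_left (by linarith)⟩
      · push Not at hpos
        have hrest : ((L.erase x₀).map fun x => χ (.ofMul x)).sum ≤ 0 :=
          (List.sum_le_card_nsmul _ 0 (by
            intro t ht
            obtain ⟨z, hz, rfl⟩ := List.mem_map.mp ht
            exact hpos z (List.mem_of_mem_erase hz))).trans_eq (smul_zero _)
        refine key x₀ hx₀ ?_
        rw [char_mul]
        exact ⟨min_le_of_right_le (by linarith), by linarith [hg.2, hpos x₀ hx₀]⟩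
    · by_cases hneg : ∃ x ∈ L, χ (.ofMul x) ≤ 0
      · obtain ⟨x, hx, hx'⟩ := hneg
        refine key x hx ?_
        have := (abs_le.mp (hbound x hx)).1
        rw [char_mul]
        exact ⟨min_le_of_left_le (by linarith), by linarith [hg.2]⟩
      · push Not at hneg
        have hrest : 0 ≤ ((L.erase x₀).map fun x => χ (.ofMul x)).sum :=
          List.sum_nonneg (by
            intro t ht
            obtain ⟨z, hz, rfl⟩ := List.mem_map.mp ht
            exact (hneg z (List.mem_of_mem_erase hz)).le)
        refine key x₀ hx₀ ?_
        rw [char_mul]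
        exact ⟨by linarith [hg.1, hneg x₀ hx₀], le_max_of_le_right (by linarith)⟩

include hy in
/-- Every value of `χ` is attained at the end of a path from `1` that does not leave the
convex hull of this value and a neighbourhood `[-c, c]` of `0`. -/
theorem exists_heightConnected_char_eq {c : ℝ} (hc0 : 0 ≤ c) (hc : ∀ i, |χ (.ofMul (y i))| ≤ c)
    (g : H) : ∃ h, χ (.ofMul h) = χ (.ofMul g) ∧ HeightConnected y χ
      (Set.Icc (min (-c) (χ (.ofMul g))) (max c (χ (.ofMul g)))) 1 h := by
  have hg : g ∈ (Subgroup.closure (Set.range y)).toSubmonoid := hy ▸ Subgroup.mem_top g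
  rw [Subgroup.closure_toSubmonoid] at hg
  obtain ⟨L, hL, hLg⟩ := Submonoid.exists_list_of_mem_closure hg
  refine exists_heightConnected_of_list χ hc _ _ L rfl hL 1 ?_ ?_
  · rw [char_one]
    exact ⟨min_le_of_left_le (by linarith), le_max_of_le_left hc0⟩
  · rw [char_one, zero_add, ← hLg]
    clear hLg hL
    induction L with
    | nil => simp
    | cons x L ih => rw [List.map_cons, List.sum_cons, List.prod_cons, char_mul, ih]

include hy in
/-- A non-zero character is unbounded along monotone paths from `1`. -/
theorem exists_heightConnected_ge {χ : Character H} (hχ : χ ≠ 0) (c : ℝ) :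
    ∃ t, c ≤ χ (.ofMul t) ∧ 0 ≤ χ (.ofMul t) ∧
      HeightConnected y χ (Set.Icc 0 (χ (.ofMul t))) 1 t := by
  -- Some generator or inverse has positive height; its powers form the path.
  obtain ⟨x, hx, hx0⟩ : ∃ x, (x ∈ Set.range y ∨ x⁻¹ ∈ Set.range y) ∧ 0 < χ (.ofMul x) := by
    by_contra! hcon
    refine hχ (AddMonoidHom.ext fun a' => ?_)
    obtain ⟨a, rfl⟩ := Additive.ofMul.surjective a'
    have ha : a ∈ Subgroup.closure (Set.range y) := hy ▸ Subgroup.mem_top _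
    change χ (.ofMul a) = 0
    induction ha using Subgroup.closure_induction with
    | mem x hx =>
      have h1 := hcon x (Or.inl hx)
      have h2 := hcon x⁻¹ (Or.inr (by rwa [inv_inv]))
      rw [char_inv] at h2
      linarith
    | one => exact char_one χ
    | mul a b _ _ iha ihb => rw [char_mul, iha, ihb, add_zero]
    | inv a _ iha => rw [char_inv, iha, neg_zero]
  have hpow : ∀ k : ℕ, χ (.ofMul (x ^ k)) = k * χ (.ofMul x) := fun k => by
    rw [ofMul_pow, map_nsmul, nsmul_eq_mul]
  have hpath : ∀ k : ℕ, HeightConnected y χ (Set.Icc 0 (χ (.ofMul (x ^ k)))) 1 (x ^ k) := by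
    intro k
    induction k with
    | zero => rw [pow_zero]; exact refl 1
    | succ k ih =>
      have hk : 0 ≤ χ (.ofMul (x ^ k)) := by rw [hpow]; positivity
      have hle : χ (.ofMul (x ^ k)) ≤ χ (.ofMul (x ^ (k + 1))) := by
        rw [pow_succ, char_mul]; linarith
      refine (ih.mono (Set.Icc_subset_Icc le_rfl hle)).trans ?_
      conv => rhs; rw [pow_succ]
      refine step hx ⟨hk, hle⟩ ?_
      rw [← pow_succ]
      exact ⟨hk.trans hle, le_rfl⟩
  obtain ⟨k, hk⟩ := exists_nat_ge (c / χ (.ofMul x))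
  refine ⟨x ^ k, ?_, ?_, hpath k⟩
  · rw [hpow]; exact (div_le_iff₀ hx0).mp hk
  · rw [hpow]; positivity

theorem halfCayleyGraph_connected_of_heightConnected
    (h : ∀ g, 0 ≤ χ (.ofMul g) → HeightConnected y χ (Set.Ici 0) 1 g) :
    (halfCayleyGraph y χ).Connected := by
  -- The equivalence of the two sign conditions is carried along because transitivity needs the
  -- middle vertex to lie in the half space.
  have key : ∀ g g', HeightConnected y χ (Set.Ici 0) g g' →
      (0 ≤ χ (.ofMul g) ↔ 0 ≤ χ (.ofMul g')) ∧
      ∀ (hg : 0 ≤ χ (.ofMul g)) (hg' : 0 ≤ χ (.ofMul g')),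
        (halfCayleyGraph y χ).Reachable ⟨g, hg⟩ ⟨g', hg'⟩ := by
    intro g g' hc
    induction hc with
    | rel a b hab =>
      obtain ⟨ha, hb, i, hi⟩ := hab
      refine ⟨iff_of_true ha hb, fun hg hg' => ?_⟩
      by_cases hne : a = b
      · subst hne; exact SimpleGraph.Reachable.refl _
      · refine SimpleGraph.Adj.reachable ?_
        change (SimpleGraph.mulCayley (Set.range y)).Adj a b
        rw [SimpleGraph.mulCayley_adj']
        exact ⟨hne, y i, ⟨i, rfl⟩, Or.inl hi.symm⟩
    | refl a => exact ⟨Iff.rfl, fun _ _ => SimpleGraph.Reachable.refl _⟩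
    | symm a b _ ih => exact ⟨ih.1.symm, fun hg hg' => (ih.2 hg' hg).symm⟩
    | trans a b c _ _ ih₁ ih₂ =>
      exact ⟨ih₁.1.trans ih₂.1, fun hg hg' =>
        (ih₁.2 hg (ih₁.1.mp hg)).trans (ih₂.2 (ih₁.1.mp hg) hg')⟩
  have h1 : 0 ≤ χ (.ofMul (1 : H)) := (char_one χ).ge
  have : Nonempty {g : H | 0 ≤ χ (.ofMul g)} := ⟨⟨1, h1⟩⟩
  refine SimpleGraph.Connected.mk fun a b => ?_
  exact ((key 1 a (h a a.2)).2 h1 a.2).symm.trans ((key 1 b (h b b.2)).2 h1 b.2)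

include hy in
/-- If the kernel of `χ` lies in one component of some half space `{-c ≤ χ}`, then
`{0 ≤ χ}` is connected. -/
theorem halfCayleyGraph_connected_of_ker [Finite Y] {χ : Character H} (hχ : χ ≠ 0) (c : ℝ)
    (h : ∀ n, χ (.ofMul n) = 0 → HeightConnected y χ (Set.Ici (-c)) 1 n) :
    (halfCayleyGraph y χ).Connected := by
  obtain ⟨B, hB⟩ := (Set.finite_range fun i => |χ (.ofMul (y i))|).bddAbove
  set d := max B 0
  have hd : ∀ i, |χ (.ofMul (y i))| ≤ d := fun i => (hB ⟨i, rfl⟩).trans (le_max_left _ _)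
  have hd0 : 0 ≤ d := le_max_right _ _
  -- Translation by `t` lifts above `0` both the kernel paths, which may dip to `-c`, and the paths
  -- to a prescribed height, which may dip to `-d`.
  obtain ⟨t, htc, ht0, ht⟩ := exists_heightConnected_ge hy hχ (max c d)
  have htc' := (le_max_left c d).trans htc
  have htd := (le_max_right c d).trans htc
  replace ht : HeightConnected y χ (Set.Ici 0) 1 t := ht.mono Set.Icc_subset_Ici_self
  refine halfCayleyGraph_connected_of_heightConnected χ fun g hg => ?_
  obtain ⟨h', hh', hpath⟩ := exists_heightConnected_char_eq hy χ hd0 hd (t⁻¹ * g)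
  rw [char_mul, char_inv] at hh' hpath
  have h1 : HeightConnected y χ (Set.Ici 0) 1 (t * h') := by
    refine ht.trans ?_
    have := hpath.translate t (J := Set.Ici 0) (fun s hs => ?_)
    · rwa [mul_one] at this
    · have := hs.1
      rw [Set.mem_Ici]
      rcases min_le_iff.mp this with h' | h' <;> linarith
  have hth : χ (.ofMul (t * h')) = χ (.ofMul g) := by rw [char_mul]; linarith
  set n := g * (t * h')⁻¹
  have hn : χ (.ofMul n) = 0 := by rw [char_mul, char_inv]; linarith
  -- The route is `1 → t → n * t → n`; its middle piece is the translate by `t` of a path to the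
  -- kernel element `t⁻¹ * n * t`.
  have h2 : HeightConnected y χ (Set.Ici 0) 1 n := by
    have h3 := (h (t⁻¹ * n * t) (by simp only [char_mul, char_inv]; linarith)).translate t
      (J := Set.Ici 0) (fun s hs => by rw [Set.mem_Ici] at hs ⊢; linarith)
    have h4 := ht.translate n (J := Set.Ici 0) (fun s hs => by rwa [hn, zero_add])
    rw [mul_one] at h3 h4
    refine (ht.trans h3).trans ?_
    convert h4.symm using 1
    group
  have h5 := h1.translate n (J := Set.Ici 0) (fun s hs => by rwa [hn, zero_add])
  rw [mul_one, inv_mul_cancel_right] at h5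
  exact h2.trans h5

include hy in
/-- If every element of the kernel of `χ` that can be reached from `1` inside `{-c ≤ χ}` can
be reached inside `{χ ≤ c'}`, then the whole kernel can be reached inside `{χ ≤ c'}`. -/
theorem heightConnected_Iic_of_Ici {χ : Character H} (hχ : χ ≠ 0) {c c' : ℝ} (hc : 0 ≤ c)
    (hc' : 0 ≤ c')
    (h : ∀ n, χ (.ofMul n) = 0 → HeightConnected y χ (Set.Ici (-c)) 1 n →
      HeightConnected y χ (Set.Iic c') 1 n) (n : H) (hn : χ (.ofMul n) = 0) :
    HeightConnected y χ (Set.Iic c') 1 n := by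
  obtain ⟨M, hM, hMc⟩ := exists_heightConnected_mul hy χ n
  have h1 := hMc 1
  rw [char_one, one_mul] at h1
  -- The path from `1` to `n` dips at most to `-M`, so its translate by `t` stays above `0`.
  obtain ⟨t, htM, ht0, ht⟩ := exists_heightConnected_ge hy hχ M
  have hm : χ (.ofMul (t * n * t⁻¹)) = 0 := by simp only [char_mul, char_inv]; linarith
  have hup : HeightConnected y χ (Set.Ici (-c)) 1 (t * n * t⁻¹) := by
    have h2 : HeightConnected y χ (Set.Ici (-c)) 1 t :=
      ht.mono fun s hs => by rw [Set.mem_Ici]; linarith [hs.1]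
    have h3 := h1.translate t (J := Set.Ici (-c))
      (fun s hs => by rw [Set.mem_Ici]; linarith [hs.1])
    have h4 := h2.translate (t * n * t⁻¹) (J := Set.Ici (-c)) (fun s hs => by rwa [hm, zero_add])
    rw [mul_one] at h3 h4
    rw [inv_mul_cancel_right] at h4
    exact (h2.trans h3).trans h4.symm
  -- The way back to `n` is `1 → t⁻¹ → n * t⁻¹ → n`, all at heights at most `c'`.
  have hlow := (h _ hm hup).translate t⁻¹ (J := Set.Iic c')
    (fun s hs => by rw [Set.mem_Iic] at hs ⊢; rw [char_inv]; linarith)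
  have h5 := ht.translate t⁻¹ (J := Set.Iic c')
    (fun s hs => by rw [Set.mem_Iic, char_inv]; linarith [hs.2])
  have h6 := h5.translate n (J := Set.Iic c') (fun s hs => by rwa [hn, zero_add])
  rw [mul_one, inv_mul_cancel] at h5
  rw [mul_one] at hlow
  rw [mul_one, inv_mul_cancel, mul_one] at h6
  refine (h5.symm.trans hlow).trans ?_
  convert h6 using 1
  group

include hy in
/-- If `-χ` is not in `Σ¹` (computed with any generating system `η`), then the half spaces
`{-c ≤ χ}` give more of the kernel than any half space `{χ ≤ c'}`. -/
theorem exists_heightConnected_Ici_not_Iic [Finite Y] {X : Type*} {η : X → H}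
    (hη : IsFiniteGeneratingSystem η) {χ : Character H} (hχ : χ ≠ 0)
    (hd : ¬ (halfCayleyGraph η (-χ)).Connected) {c c' : ℝ} (hc : 0 ≤ c) (hc' : 0 ≤ c') :
    ∃ n, χ (.ofMul n) = 0 ∧ HeightConnected y χ (Set.Ici (-c)) 1 n ∧
      ¬ HeightConnected y χ (Set.Iic c') 1 n := by
  by_contra! hcon
  have hall := heightConnected_Iic_of_Ici hy hχ hc hc' hcon
  have := hη.finite
  obtain ⟨M, hM, hch⟩ := exists_heightConnected_change hη.generates χ y
  refine hd (halfCayleyGraph_connected_of_ker hη.generates (neg_ne_zero.mpr hχ) (c' + M) ?_)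
  intro n hn
  have hn' : χ (.ofMul n) = 0 := neg_eq_zero.mp hn
  refine (hch (Set.Iic c') (Set.Iic (c' + M)) ?_ _ _ (hall n hn')).neg ?_
  · intro s hs t ht
    rw [Set.mem_Iic] at hs ⊢
    linarith [ht.2]
  · intro s hs
    rw [Set.mem_Iic] at hs
    rw [Set.mem_Ici]
    linarith

end HeightConnected

/-! ### Subgroups of the kernel cut out by heights, wreath-product cocycles, and sections of the
quotient. -/

section Amalgam

open HeightConnected

variable {G : Type*} [Group G] {Y : Type*}

theorem char_eq_zero_of_mem {χ : Character G} {n : G} (hn : n ∈ characterKer χ) :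
    χ (.ofMul n) = 0 := hn

theorem mem_characterKer {χ : Character G} {n : G} (hn : χ (.ofMul n) = 0) :
    n ∈ characterKer χ := hn

/-- The elements of the kernel of `χ` that can be reached from `1` by a path with heights
in `I`. -/
def heightSubgroup (y : Y → G) (χ : Character G) (I : Set ℝ) : Subgroup (characterKer χ) where
  carrier := {n | HeightConnected y χ I 1 (n : G)}
  one_mem' := HeightConnected.refl 1
  mul_mem' {a b} ha hb := by
    have h := HeightConnected.translate hb (a : G) (J := I)
      (fun t ht => by rwa [char_eq_zero_of_mem a.2, zero_add])
    rw [mul_one] at h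
    exact HeightConnected.trans ha h
  inv_mem' {a} ha := by
    have h := HeightConnected.translate ha ((a : G)⁻¹) (J := I)
      (fun t ht => by rwa [char_inv, char_eq_zero_of_mem a.2, neg_zero, zero_add])
    rw [mul_one, inv_mul_cancel] at h
    exact h.symm

theorem mem_heightSubgroup {y : Y → G} {χ : Character G} {I : Set ℝ} {n : characterKer χ} :
    n ∈ heightSubgroup y χ I ↔ HeightConnected y χ I 1 (n : G) := Iff.rfl

theorem heightSubgroup_mono (y : Y → G) (χ : Character G) {I J : Set ℝ} (h : I ⊆ J) :
    heightSubgroup y χ I ≤ heightSubgroup y χ J := fun _ hn => HeightConnected.mono hn h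

/-- The action of `G` on the functions on a quotient by right translations of the argument. -/
def translateAut (N : Subgroup G) [N.Normal] (P : Type*) [Group P] :
    G →* MulAut (G ⧸ N → P) where
  toFun g :=
    { toFun := fun F q => F (q * (g : G ⧸ N))
      invFun := fun F q => F (q * (g : G ⧸ N)⁻¹)
      left_inv := fun F => by ext q; simp
      right_inv := fun F => by ext q; simp
      map_mul' := fun F F' => rfl }
  map_one' := by ext F q; simp
  map_mul' a b := by ext F q; simp [mul_assoc]

section Cocycle

variable {N : Subgroup G} [N.Normal] {P : Type*} [Group P] {K : Type*} [Group K]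
  (Ψ : K →* (G ⧸ N → P) ⋊[translateAut N P] G)

/-- The cocycle identity: the value on a product, started at `q`, is read off along the concatenated
path. -/
theorem left_map_mul (a b : K) (q : G ⧸ N) :
    (Ψ (a * b)).left q = (Ψ a).left q * (Ψ b).left (q * ((Ψ a).right : G ⧸ N)) := by
  rw [map_mul, SemidirectProduct.mul_left]
  rfl

theorem left_map_inv (a : K) (q : G ⧸ N) :
    (Ψ a⁻¹).left q = ((Ψ a).left (q * ((Ψ a).right : G ⧸ N)⁻¹))⁻¹ := by
  rw [eq_inv_iff_mul_eq_one]
  have := left_map_mul Ψ a⁻¹ a q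
  rw [inv_mul_cancel, map_one, map_inv, SemidirectProduct.inv_right] at this
  rw [map_inv]
  exact this.symm

/-- A cocycle takes values in a subgroup along every path in `I` if it does so along the edges
in `I`. -/
theorem left_mem_of_heightConnected {z : Y → K} {ψ : Character K} (ht : G ⧸ N → ℝ)
    (hψ : ∀ k, ψ (.ofMul k) = ht ((Ψ k).right : G ⧸ N)) (I : Set ℝ) (T : Subgroup P)
    (hT : ∀ i q, ht q ∈ I → ht (q * ((Ψ (z i)).right : G ⧸ N)) ∈ I → (Ψ (z i)).left q ∈ T)
    {u v : K} (h : HeightConnected z ψ I u v) :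
    (Ψ (u⁻¹ * v)).left ((Ψ u).right : G ⧸ N) ∈ T := by
  have hright : ∀ a b : K, ((Ψ a).right : G ⧸ N) * ((Ψ (a⁻¹ * b)).right : G ⧸ N) =
      ((Ψ b).right : G ⧸ N) := fun a b => by simp
  induction h with
  | rel a b hab =>
    obtain ⟨ha, hb, i, rfl⟩ := hab
    rw [inv_mul_cancel_left]
    refine hT i _ (by rwa [← hψ]) ?_
    rw [hψ, map_mul] at hb
    simpa using hb
  | refl a => rw [inv_mul_cancel, map_one]; exact T.one_mem
  | symm a b _ ih =>
    have := left_map_inv Ψ (a⁻¹ * b) ((Ψ b).right : G ⧸ N)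
    rw [mul_inv_rev, inv_inv, ← hright a b, mul_inv_cancel_right, hright] at this
    rw [this]
    exact T.inv_mem ih
  | trans a b c _ _ ih₁ ih₂ =>
    have := left_map_mul Ψ (a⁻¹ * b) (b⁻¹ * c) ((Ψ a).right : G ⧸ N)
    rw [hright, mul_assoc, mul_inv_cancel_left] at this
    rw [this]
    exact T.mul_mem ih₁ ih₂

end Cocycle

section Section

variable {y : Y → G} (hy : Subgroup.closure (Set.range y) = ⊤) (χ : Character G)

theorem char_eq_of_mk_eq {a b : G} (h : (a : G ⧸ characterKer χ) = b) :
    χ (.ofMul a) = χ (.ofMul b) := by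
  have := char_eq_zero_of_mem (QuotientGroup.eq.mp h)
  rw [char_mul, char_inv] at this
  linarith

-- A single section serves both halves and the strip, since each is order-connected and contains
-- `[-c, c]`. The normalization `σ 1 = 1` later makes evaluation at the coset `1` return the kernel
-- element itself, not a conjugate.
include hy in
theorem exists_section {c : ℝ} (hc0 : 0 ≤ c) (hc : ∀ i, |χ (.ofMul (y i))| ≤ c) :
    ∃ σ : G ⧸ characterKer χ → G, (∀ q, (σ q : G ⧸ characterKer χ) = q) ∧ σ 1 = 1 ∧
      ∀ I : Set ℝ, I.OrdConnected → Set.Icc (-c) c ⊆ I → ∀ q, χ (.ofMul (σ q)) ∈ I →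
        HeightConnected y χ I 1 (σ q) := by
  have key : ∀ q : G ⧸ characterKer χ, ∃ h : G, (h : G ⧸ characterKer χ) = q ∧
      (q = 1 → h = 1) ∧ ∀ I : Set ℝ, I.OrdConnected → Set.Icc (-c) c ⊆ I → χ (.ofMul h) ∈ I →
        HeightConnected y χ I 1 h := by
    intro q
    by_cases hq : q = 1
    · exact ⟨1, by rw [hq]; rfl, fun _ => rfl, fun _ _ _ _ => refl 1⟩
    obtain ⟨g, rfl⟩ := QuotientGroup.mk_surjective q
    obtain ⟨h, hh, hp⟩ := exists_heightConnected_char_eq hy χ hc0 hc g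
    refine ⟨h, ?_, fun h' => absurd h' hq, fun I hI hcI hhI => hp.mono ?_⟩
    · rw [QuotientGroup.eq]
      refine mem_characterKer ?_
      rw [char_mul, char_inv]; linarith
    · rw [← hh]
      have h1 : -c ∈ I := hcI ⟨le_rfl, by linarith⟩
      have h2 : c ∈ I := hcI ⟨by linarith, le_rfl⟩
      refine hI.out ?_ ?_
      · rcases min_choice (-c) (χ (.ofMul h)) with h' | h' <;> rw [h'] <;> assumption
      · rcases max_choice c (χ (.ofMul h)) with h' | h' <;> rw [h'] <;> assumption
  choose σ hσ hσ1 hσp using key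
  exact ⟨σ, hσ, hσ1 1 rfl, fun I hI hcI q => hσp q I hI hcI⟩

/-- The loop at `1` through the edge labelled `i` at the vertex `q` of the quotient graph. -/
theorem edge_loop_mem {σ : G ⧸ characterKer χ → G}
    (hσ : ∀ q, (σ q : G ⧸ characterKer χ) = q) (g : G) (q : G ⧸ characterKer χ) :
    σ q * g * (σ (q * g))⁻¹ ∈ characterKer χ := by
  rw [← QuotientGroup.eq_one_iff]
  simp only [QuotientGroup.mk_mul, QuotientGroup.mk_inv, hσ]
  group

theorem edge_loop_mem_heightSubgroup {σ : G ⧸ characterKer χ → G}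
    (hσ : ∀ q, (σ q : G ⧸ characterKer χ) = q) {I : Set ℝ}
    (hI : ∀ q, χ (.ofMul (σ q)) ∈ I → HeightConnected y χ I 1 (σ q)) (i : Y)
    (q : G ⧸ characterKer χ) (h1 : χ (.ofMul (σ q)) ∈ I) (h2 : χ (.ofMul (σ (q * y i))) ∈ I) :
    (⟨_, edge_loop_mem χ hσ (y i) q⟩ : characterKer χ) ∈ heightSubgroup y χ I := by
  rw [mem_heightSubgroup]
  have h0 := char_eq_zero_of_mem (edge_loop_mem χ hσ (y i) q)
  have h3 := (hI _ h2).translate (σ q * y i * (σ (q * y i))⁻¹) (J := I)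
    (fun t ht => by rwa [h0, zero_add])
  rw [mul_one, inv_mul_cancel_right] at h3
  refine ((hI q h1).trans (step (Or.inl ⟨i, rfl⟩) h1 ?_)).trans h3.symm
  rwa [char_eq_of_mk_eq χ (a := σ q * y i) (b := σ (q * y i))
    (by rw [hσ, QuotientGroup.mk_mul, hσ])]

end Section

end Amalgam

/-! ### The kernel as an amalgam of its two halves. -/

section AmalgamDecomposition

variable {G : Type*} [Group G]

/-- On one factor the map to `N` is a subgroup inclusion, so no normal form is needed. Every
equality in the amalgam is later checked inside one factor by this means. -/
theorem amalgamMap_injOn_range {N : Type*} [Group N] {ι : Type*} (S : Subgroup N)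
    (A : ι → Subgroup N) (h : ∀ i, S ≤ A i) (i : ι) {p p' : Monoid.PushoutI
      (fun i => Subgroup.inclusion (h i))} (hp : p ∈ (Monoid.PushoutI.of
        (φ := fun i => Subgroup.inclusion (h i)) i).range)
    (hp' : p' ∈ (Monoid.PushoutI.of (φ := fun i => Subgroup.inclusion (h i)) i).range)
    (hpp : amalgamMap S A h p = amalgamMap S A h p') : p = p' := by
  obtain ⟨a, rfl⟩ := hp
  obtain ⟨b, rfl⟩ := hp'
  rw [amalgamMap_of, amalgamMap_of] at hpp
  rw [Subtype.ext hpp]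

variable {Y : Type*} {f : FreeGroup Y →* G}

/-- The half space `{χ ≤ c}` for `false` and `{-c ≤ χ}` for `true`. -/
def half (c : ℝ) (i : Bool) : Set ℝ := cond i (Set.Ici (-c)) (Set.Iic c)

theorem ordConnected_half (c : ℝ) (i : Bool) : (half c i).OrdConnected := by
  cases i
  · exact Set.ordConnected_Iic
  · exact Set.ordConnected_Ici

theorem Icc_subset_half (c : ℝ) (i : Bool) : Set.Icc (-c) c ⊆ half c i := by
  cases i
  · exact Set.Icc_subset_Iic_self
  · exact Set.Icc_subset_Ici_self

theorem Icc_sub_add_subset_half (c s : ℝ) : ∃ i, Set.Icc (s - c) (s + c) ⊆ half c i := by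
  rcases le_total 0 s with hs | hs
  · exact ⟨true, fun t ht => show -c ≤ t by linarith [ht.1]⟩
  · exact ⟨false, fun t ht => show t ≤ c by linarith [ht.2]⟩

/-- The two halves of the kernel of `χ`. -/
def halfSubgroup (y : Y → G) (χ : Character G) (c : ℝ) (i : Bool) : Subgroup (characterKer χ) :=
  heightSubgroup y χ (half c i)

theorem strip_le_halfSubgroup (y : Y → G) (χ : Character G) (c : ℝ) (i : Bool) :
    heightSubgroup y χ (Set.Icc (-c) c) ≤ halfSubgroup y χ c i :=
  heightSubgroup_mono y χ (Icc_subset_half c i)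

/-- The free product of the two halves amalgamated along the strip. -/
abbrev HalfAmalgam (y : Y → G) (χ : Character G) (c : ℝ) : Type _ :=
  Monoid.PushoutI (fun i => Subgroup.inclusion (strip_le_halfSubgroup y χ c i))

/-- The canonical map from the amalgam of the halves to the kernel of `χ`. -/
abbrev halfAmalgamMap (y : Y → G) (χ : Character G) (c : ℝ) :
    HalfAmalgam y χ c →* characterKer χ :=
  amalgamMap (heightSubgroup y χ (Set.Icc (-c) c)) (halfSubgroup y χ c)
    (strip_le_halfSubgroup y χ c)

/-- The image of one of the halves in the amalgam. -/
abbrev halfRange (y : Y → G) (χ : Character G) (c : ℝ) (i : Bool) : Subgroup (HalfAmalgam y χ c) :=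
  (Monoid.PushoutI.of (φ := fun i => Subgroup.inclusion (strip_le_halfSubgroup y χ c i)) i).range

/-- Lifts of the edge loops to the amalgam, compatible with both halves. -/
theorem exists_edge_lift {y : Y → G} {χ : Character G} {c : ℝ}
    (hc : ∀ i, |χ (.ofMul (y i))| ≤ c) {σ : G ⧸ characterKer χ → G}
    (hσ : ∀ q, (σ q : G ⧸ characterKer χ) = q)
    (hσI : ∀ I : Set ℝ, I.OrdConnected → Set.Icc (-c) c ⊆ I → ∀ q, χ (.ofMul (σ q)) ∈ I →
        HeightConnected y χ I 1 (σ q)) (q : G ⧸ characterKer χ) (i : Y) :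
    ∃ p : HalfAmalgam y χ c, (halfAmalgamMap y χ c p : G) = σ q * y i * (σ (q * y i))⁻¹ ∧
      ∀ b, χ (.ofMul (σ q)) ∈ half c b → χ (.ofMul (σ (q * y i))) ∈ half c b →
        p ∈ halfRange y χ c b := by
  set l : characterKer χ := ⟨_, edge_loop_mem χ hσ (y i) q⟩ with hl
  have hmem : ∀ I : Set ℝ, I.OrdConnected → Set.Icc (-c) c ⊆ I → χ (.ofMul (σ q)) ∈ I →
      χ (.ofMul (σ (q * y i))) ∈ I → l ∈ heightSubgroup y χ I := fun I hI hcI =>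
    edge_loop_mem_heightSubgroup χ hσ (hσI I hI hcI) i q
  -- An edge in both halves lies in the strip, and its lift must come from the base group to belong
  -- to both factors. Any other edge lies in exactly one half, because its height changes by at most
  -- `c`.
  by_cases hboth : ∀ b, χ (.ofMul (σ q)) ∈ half c b ∧ χ (.ofMul (σ (q * y i))) ∈ half c b
  · have hl0 := hmem (Set.Icc (-c) c) Set.ordConnected_Icc le_rfl
      ⟨(hboth true).1, (hboth false).1⟩ ⟨(hboth true).2, (hboth false).2⟩
    refine ⟨Monoid.PushoutI.base _ ⟨l, hl0⟩, ?_, fun b _ _ => ?_⟩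
    · rw [halfAmalgamMap, amalgamMap_base]
    · rw [← Monoid.PushoutI.of_apply_eq_base _ b]
      exact ⟨_, rfl⟩
  · have hb : ∃ b, χ (.ofMul (σ q)) ∈ half c b ∧ χ (.ofMul (σ (q * y i))) ∈ half c b := by
      obtain ⟨b, hb⟩ := Icc_sub_add_subset_half c (χ (.ofMul (σ q)))
      have h1 : χ (.ofMul (σ (q * y i))) = χ (.ofMul (σ q)) + χ (.ofMul (y i)) := by
        rw [← char_mul]
        exact char_eq_of_mk_eq χ (by rw [hσ, QuotientGroup.mk_mul, hσ])
      have h2 := abs_le.mp (hc i)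
      exact ⟨b, hb ⟨by linarith, by linarith⟩, hb ⟨by linarith, by linarith⟩⟩
    obtain ⟨b, hb⟩ := hb
    have hlb : l ∈ halfSubgroup y χ c b :=
      hmem _ (ordConnected_half c b) (Icc_subset_half c b) hb.1 hb.2
    refine ⟨Monoid.PushoutI.of b ⟨l, hlb⟩, ?_, fun b' h1 h2 => ?_⟩
    · rw [halfAmalgamMap, amalgamMap_of]
    · by_cases hbb : b' = b
      · subst hbb; exact ⟨_, rfl⟩
      · exfalso
        refine hboth fun b'' => ?_
        have : b'' = b ∨ b'' = b' := by
          cases b <;> cases b' <;> cases b'' <;> simp_all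
        rcases this with rfl | rfl
        · exact hb
        · exact ⟨h1, h2⟩

/-- The kernel of `χ` is the free product of its two halves, amalgamated along the strip, if the
strip is wide enough for every relator to fit into one of the half spaces. -/
theorem halfAmalgamMap_bijective (hf : Function.Surjective f) {R : Set (FreeGroup Y)}
    (hR : Subgroup.normalClosure R = f.ker) (χ : Character G) {c : ℝ} (hc0 : 0 ≤ c)
    (hc : ∀ i, |χ (.ofMul (f (.of i)))| ≤ c)
    (hcR : ∀ r ∈ R, ∀ u, HeightConnected FreeGroup.of (χ.comp (MonoidHom.toAdditive f))
      (Set.Icc (χ (.ofMul (f u)) - c) (χ (.ofMul (f u)) + c)) u (u * r)) :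
    Function.Bijective (halfAmalgamMap (f ∘ FreeGroup.of) χ c) := by
  set y := f ∘ FreeGroup.of with hydef
  have hy : Subgroup.closure (Set.range y) = ⊤ := by
    rw [Set.range_comp, ← MonoidHom.map_closure, FreeGroup.closure_range_of,
      ← MonoidHom.range_eq_map, MonoidHom.range_eq_top.mpr hf]
  obtain ⟨σ, hσ, hσ1, hσI⟩ := exists_section hy χ hc0 hc
  choose γ hγ hγb using exists_edge_lift hc hσ hσI
  set Θ := halfAmalgamMap y χ c
  have hheight : ∀ g : G, χ (.ofMul g) = χ (.ofMul (σ (g : G ⧸ characterKer χ))) := fun g =>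
    char_eq_of_mk_eq χ (hσ _).symm
  -- The left component of `Φ w` at `q` is the product in the amalgam of the edge lifts along the
  -- path `w` starting at `q`.
  let Φ : FreeGroup Y →* (G ⧸ characterKer χ → HalfAmalgam y χ c) ⋊[translateAut _ _] G :=
    FreeGroup.lift fun i => ⟨fun q => γ q i, y i⟩
  have hΦof : ∀ i, Φ (.of i) = ⟨fun q => γ q i, y i⟩ := fun i => FreeGroup.lift_apply_of
  have hΦright : ∀ w, (Φ w).right = f w := by
    have : SemidirectProduct.rightHom.comp Φ = f := by
      ext i
      rw [MonoidHom.comp_apply, hΦof]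
      rfl
    exact fun w => DFunLike.congr_fun this w
  have hΘ : ∀ w q, (Θ ((Φ w).left q) : G) = σ q * f w * (σ (q * f w))⁻¹ := by
    intro w
    induction w using FreeGroup.induction_on with
    | C1 => intro q; simp
    | of i => intro q; rw [hΦof]; exact hγ q i
    | inv_of i ih =>
      intro q
      rw [left_map_inv, map_inv, Subgroup.coe_inv, ih, hΦright, map_inv, QuotientGroup.mk_inv]
      simp [mul_assoc]
    | mul a b iha ihb =>
      intro q
      rw [left_map_mul, map_mul, Subgroup.coe_mul, iha, ihb, hΦright, map_mul,
        QuotientGroup.mk_mul, mul_assoc q]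
      group
  have hker : f.ker ≤ Φ.ker := by
    rw [← hR]
    refine Subgroup.normalClosure_le_normal fun r hr => ?_
    have hfr : f r = 1 := by
      rw [← MonoidHom.mem_ker, ← hR]; exact Subgroup.subset_normalClosure hr
    refine MonoidHom.mem_ker.mpr (SemidirectProduct.ext ?_ ?_)
    · funext q
      obtain ⟨u, hu⟩ := hf (σ q)
      -- The relator loop at `q` fits into the half `b`, so its value lies in one factor and may be
      -- compared with `1` in `N`.
      obtain ⟨b, hb⟩ := Icc_sub_add_subset_half c (χ (.ofMul (f u)))
      have h1 := left_mem_of_heightConnected Φ (fun q => χ (.ofMul (σ q)))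
        (fun k => by rw [hΦright]; exact hheight (f k)) (half c b) (halfRange y χ c b)
        (fun i q h1 h2 => by
          rw [hΦof] at h2 ⊢
          exact hγb q i b h1 h2) ((hcR r hr u).mono hb)
      rw [inv_mul_cancel_left, hΦright, hu, hσ] at h1
      refine amalgamMap_injOn_range _ _ _ b h1 (Subgroup.one_mem _) (Subtype.ext ?_)
      refine (hΘ r q).trans ?_
      rw [hfr]
      simp
    · rw [hΦright, hfr]; rfl
  let Ψ := f.liftOfSurjective hf ⟨Φ, hker⟩
  have hΨ : ∀ w, Ψ (f w) = Φ w := fun w =>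
    f.liftOfRightInverse_comp_apply _ (Function.rightInverse_surjInv hf) ⟨Φ, hker⟩ w
  have hΨright : ∀ g, (Ψ g).right = g := fun g => by
    obtain ⟨w, rfl⟩ := hf g
    rw [hΨ, hΦright]
  have hΨΘ : ∀ g q, (Θ ((Ψ g).left q) : G) = σ q * g * (σ (q * g))⁻¹ := fun g q => by
    obtain ⟨w, rfl⟩ := hf g
    rw [hΨ, hΘ]
  have hone : ∀ n : characterKer χ, ((n : G) : G ⧸ characterKer χ) = 1 := fun n =>
    (QuotientGroup.eq_one_iff _).mpr n.2
  have hΘker : ∀ n : characterKer χ, Θ ((Ψ n).left 1) = n := fun n => by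
    refine Subtype.ext ?_
    rw [hΨΘ, hone, mul_one, hσ1]
    simp
  -- Kernel elements fix the coset `1`, so the cocycle evaluated there is a homomorphism.
  let Λ : characterKer χ →* HalfAmalgam y χ c :=
    MonoidHom.mk' (fun n => (Ψ n).left 1) fun a b => by
      rw [Subgroup.coe_mul, left_map_mul, hΨright, hone, mul_one]
  -- It suffices to check each factor. A path inside a half keeps the value of `Λ` in the
  -- corresponding factor, where injectivity applies.
  have hΛ : Λ.comp Θ = MonoidHom.id _ := by
    refine Monoid.PushoutI.hom_ext_nonempty fun b => MonoidHom.ext fun x => ?_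
    have h1 := left_mem_of_heightConnected Ψ (fun q => χ (.ofMul (σ q)))
      (fun k => by rw [hΨright]; exact hheight k) (half c b) (halfRange y χ c b)
      (fun i q h1 h2 => by
        rw [hΨright] at h2
        have : Ψ (y i) = _ := (hΨ (.of i)).trans (hΦof i)
        rw [this]
        exact hγb q i b h1 h2) (mem_heightSubgroup.mp x.2)
    rw [inv_one, one_mul, hΨright, QuotientGroup.mk_one] at h1
    refine amalgamMap_injOn_range _ _ _ b ?_ ⟨x, rfl⟩ ?_
    · rw [MonoidHom.comp_apply, MonoidHom.comp_apply, amalgamMap_of]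
      exact h1
    · exact hΘker _
  refine ⟨fun p p' hpp => ?_, fun n => ⟨_, hΘker n⟩⟩
  have h1 : ∀ p, Λ (Θ p) = p := DFunLike.congr_fun hΛ
  rw [← h1 p, hpp, h1]

end AmalgamDecomposition

/-! ### Reduced words in an amalgam and free subgroups by ping-pong. -/

section PingPong

variable {N : Type*} [Group N]

/-- `g` is a product of elements outside `S`, taken alternatingly from the subgroups `A true` and
`A false` and beginning in `A i`. -/
inductive IsAlternating (S : Subgroup N) (A : Bool → Subgroup N) : Bool → N → Prop
  | single {i : Bool} {x : N} (hx : x ∈ A i) (hS : x ∉ S) : IsAlternating S A i x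
  | cons {i : Bool} {x g : N} (hx : x ∈ A i) (hS : x ∉ S) (hg : IsAlternating S A (!i) g) :
      IsAlternating S A i (x * g)

variable {S : Subgroup N} {A : Bool → Subgroup N}

theorem IsAlternating.exists_reduced (h : ∀ i, S ≤ A i) {i : Bool} {g : N}
    (hg : IsAlternating S A i g) :
    ∃ w : Monoid.CoprodI.Word (fun i => A i), w.fstIdx = some i ∧
      Monoid.PushoutI.Reduced (fun i => Subgroup.inclusion (h i)) w ∧
      amalgamMap S A h (Monoid.PushoutI.ofCoprodI w.prod) = g := by
  have hrange : ∀ (i : Bool) (x : N) (hx : x ∈ A i), x ∉ S →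
      (⟨x, hx⟩ : A i) ∉ (Subgroup.inclusion (h i)).range := by
    rintro i x hx hS ⟨s, hs⟩
    have h1 : (s : N) = x := congrArg Subtype.val hs
    exact hS (h1 ▸ s.2)
  have hone : ∀ (i : Bool) (x : N) (hx : x ∈ A i), x ∉ S → (⟨x, hx⟩ : A i) ≠ 1 := by
    intro i x hx hS h1
    have h2 : x = 1 := congrArg Subtype.val h1
    exact hS (h2 ▸ S.one_mem)
  have hcons : ∀ (i : Bool) (x : N) (hx : x ∈ A i) (hS : x ∉ S)
      (w : Monoid.CoprodI.Word (fun i => A i)) (hw : w.fstIdx ≠ some i),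
      Monoid.PushoutI.Reduced (fun i => Subgroup.inclusion (h i)) w →
      Monoid.PushoutI.Reduced (fun i => Subgroup.inclusion (h i))
        (Monoid.CoprodI.Word.cons ⟨x, hx⟩ w hw (hone i x hx hS)) ∧
      amalgamMap S A h (Monoid.PushoutI.ofCoprodI
        (Monoid.CoprodI.Word.cons ⟨x, hx⟩ w hw (hone i x hx hS)).prod) =
        x * amalgamMap S A h (Monoid.PushoutI.ofCoprodI w.prod) := by
    intro i x hx hS w hw hred
    refine ⟨?_, ?_⟩
    · intro l hl
      rcases List.mem_cons.mp hl with rfl | hl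
      · exact hrange i x hx hS
      · exact hred l hl
    · rw [Monoid.CoprodI.Word.prod_cons, map_mul, map_mul, Monoid.PushoutI.ofCoprodI_of,
        amalgamMap_of]
  induction hg with
  | @single i x hx hS =>
    have := hcons i x hx hS Monoid.CoprodI.Word.empty (by simp [Monoid.CoprodI.Word.fstIdx])
      (by intro l hl; exact absurd hl List.not_mem_nil)
    exact ⟨_, rfl, this.1, by rw [this.2]; simp⟩
  | @cons i x g hx hS _ ih =>
    obtain ⟨w, hw, hred, rfl⟩ := ih
    have := hcons i x hx hS w (by rw [hw]; simp) hred
    exact ⟨_, rfl, this.1, this.2⟩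

theorem not_isAlternating_one (h : ∀ i, S ≤ A i) (hinj : Function.Injective (amalgamMap S A h))
    (i : Bool) : ¬ IsAlternating S A i 1 := by
  intro hg
  obtain ⟨w, hw, hred, hone⟩ := hg.exists_reduced h
  have h1 : Monoid.PushoutI.ofCoprodI w.prod = 1 := hinj (by rw [hone, map_one])
  have h2 := hred.eq_empty_of_mem_range (fun i => Subgroup.inclusion_injective (h i))
    (by rw [h1]; exact Subgroup.one_mem _)
  rw [h2] at hw
  simp [Monoid.CoprodI.Word.fstIdx] at hw

/-- If `g` began in both factors, `g⁻¹ * g` would be a reduced word with value `1`. -/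
theorem IsAlternating.not_bnot (h : ∀ i, S ≤ A i)
    (hinj : Function.Injective (amalgamMap S A h)) {i : Bool} {g : N}
    (hg : IsAlternating S A i g) : ¬ IsAlternating S A (!i) g := by
  have key : ∀ {i : Bool} {g : N}, IsAlternating S A i g →
      ∀ g', IsAlternating S A (!i) g' → g⁻¹ * g' ≠ 1 := by
    intro i g hg
    induction hg with
    | @single i x hx hS =>
      intro g' hg' h1
      refine not_isAlternating_one h hinj i (h1 ▸ ?_)
      exact .cons ((A i).inv_mem hx) (fun h => hS (S.inv_mem_iff.mp h)) hg'
    | @cons i x g hx hS _ ih =>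
      intro g' hg' h1
      refine ih (x⁻¹ * g') ?_ (by rw [← h1]; group)
      rw [Bool.not_not]
      exact .cons ((A i).inv_mem hx) (fun h => hS (S.inv_mem_iff.mp h)) hg'
  exact fun hg' => key hg g hg' (inv_mul_cancel g)

/-- Consecutive copies of `b * a * b'` meet in the letter `b' * b`, which lies outside `S`; hence
powers stay reduced. -/
theorem IsAlternating.pow_mul {a b b' : N} (ha : a ∈ A true) (haS : a ∉ S) (hb : b ∈ A false)
    (hbS : b ∉ S) (hb' : b' ∈ A false) (hbS' : b' ∉ S) (hbb : b' * b ∉ S) (n : ℕ) {p : N}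
    (hp : IsAlternating S A true p) :
    IsAlternating S A false ((b * a * b') ^ (n + 1) * p) := by
  have key : ∃ p', IsAlternating S A true p' ∧ (b * a * b') ^ (n + 1) * p = b * p' := by
    induction n with
    | zero =>
      exact ⟨a * (b' * p), .cons ha haS (.cons hb' hbS' hp), by simp [mul_assoc]⟩
    | succ n ih =>
      obtain ⟨p', hp', he⟩ := ih
      refine ⟨a * (b' * b * p'), .cons ha haS (.cons (mul_mem hb' hb) hbb hp'), ?_⟩
      rw [pow_succ', mul_assoc _ _ p, he]
      simp [mul_assoc]
  obtain ⟨p', hp', he⟩ := key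
  rw [he]
  exact .cons hb hbS hp'

theorem IsAlternating.zpow_mul {a b b' : N} (ha : a ∈ A true) (haS : a ∉ S) (hb : b ∈ A false)
    (hbS : b ∉ S) (hb' : b' ∈ A false) (hbS' : b' ∉ S) (hbb : b' * b ∉ S) {n : ℤ} (hn : n ≠ 0)
    {p : N} (hp : IsAlternating S A true p) :
    IsAlternating S A false ((b * a * b') ^ n * p) := by
  rcases n with (_ | n) | n
  · exact absurd rfl hn
  · rw [Int.ofNat_eq_natCast, zpow_natCast]
    exact hp.pow_mul ha haS hb hbS hb' hbS' hbb n
  -- The inverse has the same shape, with junction letter `(b' * b)⁻¹`.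
  · have : (b * a * b') ^ (Int.negSucc n) = (b'⁻¹ * a⁻¹ * b⁻¹) ^ (n + 1) := by
      rw [zpow_negSucc, ← inv_pow]
      simp [mul_assoc]
    rw [this]
    refine hp.pow_mul (inv_mem ha) ?_ (inv_mem hb') ?_ (inv_mem hb) ?_ ?_ n
    · rwa [S.inv_mem_iff]
    · rwa [S.inv_mem_iff]
    · rwa [S.inv_mem_iff]
    · rwa [← mul_inv_rev, S.inv_mem_iff]

-- The free generators are `b * a * b'` and its conjugate by `a`. The ping-pong sets are the
-- translates by `1` and `a` of the words beginning in `A false`. They are disjoint because passing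
-- from one to the other prepends a letter of `A true` outside `S`.
open scoped Pointwise in
theorem exists_injective_freeGroup_bool (h : ∀ i, S ≤ A i)
    (hinj : Function.Injective (amalgamMap S A h)) {a b b' : N} (ha : a ∈ A true) (haS : a ∉ S)
    (hb : b ∈ A false) (hbS : b ∉ S) (hb' : b' ∈ A false) (hbS' : b' ∉ S) (hbb : b' * b ∉ S) :
    ∃ F : FreeGroup Bool →* N, Function.Injective F := by
  let s : Bool → N := fun i => cond i a 1
  have hs : ∀ i j, i ≠ j → (s i)⁻¹ * s j ∈ A true ∧ (s i)⁻¹ * s j ∉ S := by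
    intro i j hij
    cases i <;> cases j <;> simp_all [s]
  let x : Bool → N := fun i => s i * (b * a * b') * (s i)⁻¹
  let X : Bool → Set N := fun i => {g | IsAlternating S A false ((s i)⁻¹ * g)}
  have hlift : Function.Injective
      (Monoid.CoprodI.lift fun i : Bool => FreeGroup.lift fun _ : Unit => x i) := by
    refine Monoid.CoprodI.lift_injective_of_ping_pong _ ?_ X ?_ ?_ ?_
    -- With only two factors, ping-pong needs one of order at least three; here it is infinite
    -- cyclic.
    · refine Or.inr ⟨true, ?_⟩
      rw [← Cardinal.mk_congr FreeGroup.freeGroupUnitEquivInt.symm]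
      exact (Cardinal.natCast_le_aleph0 (n := 3)).trans (Cardinal.aleph0_le_mk _)
    · intro i
      exact ⟨s i * b, by simpa [X] using IsAlternating.single hb hbS⟩
    · intro i j hij
      refine Set.disjoint_left.mpr fun g hi hj => ?_
      refine IsAlternating.not_bnot h hinj hi ?_
      have := IsAlternating.cons (hs i j hij).1 (hs i j hij).2 hj
      simpa [mul_assoc] using this
    · intro i j hij w hw
      rw [Set.smul_set_subset_iff]
      intro g hg
      obtain ⟨n, rfl⟩ := FreeGroup.freeGroupUnitEquivInt.symm.surjective w
      have hn : n ≠ 0 := by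
        rintro rfl
        exact hw rfl
      have hxi : FreeGroup.lift (fun _ : Unit => x i)
          (FreeGroup.freeGroupUnitEquivInt.symm n) = s i * (b * a * b') ^ n * (s i)⁻¹ := by
        simp [FreeGroup.freeGroupUnitEquivInt, x, conj_zpow]
      rw [hxi]
      have := IsAlternating.zpow_mul ha haS hb hbS hb' hbS' hbb hn
        (IsAlternating.cons (hs i j hij).1 (hs i j hij).2 hg)
      simpa [X, mul_assoc] using this
  exact ⟨(Monoid.CoprodI.lift fun i : Bool => FreeGroup.lift fun _ : Unit => x i).comp
    freeGroupEquivCoprodI.toMonoidHom, hlift.comp freeGroupEquivCoprodI.injective⟩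

theorem hasNonabelianFreeSubgroup_of_injective {N : Type u} [Group N] (F : FreeGroup Bool →* N)
    (hF : Function.Injective F) : HasNonabelianFreeSubgroup N := by
  refine ⟨F.range, IsFreeGroup.ofMulEquiv (MonoidHom.ofInjective hF),
    ⟨F (.of true), _, rfl⟩, ⟨F (.of false), _, rfl⟩, fun hcomm => ?_⟩
  have h1 : F (.of true * .of false) = F (.of false * .of true) := by
    rw [map_mul, map_mul]; exact Subtype.ext_iff.mp hcomm
  exact absurd (hF h1) (by decide)

theorem hasNonabelianFreeSubgroup_of_injective_hom {N : Type u} [Group N] {M : Type v}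
    [Group M] (f : N →* M) (hf : Function.Injective f) (h : HasNonabelianFreeSubgroup N) :
    HasNonabelianFreeSubgroup M := by
  obtain ⟨F, hF, a, b, hab⟩ := h
  let e := F.equivMapOfInjective f hf
  refine ⟨F.map f, ⟨?_⟩, e a, e b, fun hcomm => hab (e.injective (by rwa [map_mul, map_mul]))⟩
  exact ((IsFreeGroup.basis F).map e).isFreeGroup.nonempty_basis

/-- A free product with amalgamation along a subgroup of infinite index in both factors contains
a non-abelian free subgroup. -/
theorem hasNonabelianFreeSubgroup_of_amalgam {N : Type u} [Group N] {S : Subgroup N}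
    {A : Bool → Subgroup N} (h : ∀ i, S ≤ A i) (hinj : Function.Injective (amalgamMap S A h))
    (hindex : ∀ i, (S.subgroupOf (A i)).index = 0) : HasNonabelianFreeSubgroup N := by
  have hinf : ∀ i, Infinite (A i ⧸ S.subgroupOf (A i)) := fun i =>
    Subgroup.index_eq_zero_iff_infinite.mp (hindex i)
  have hne : ∀ i (T : Finset (A i ⧸ S.subgroupOf (A i))), ∃ a : A i,
      (a : A i ⧸ S.subgroupOf (A i)) ∉ T := fun i T => by
    have := hinf i
    obtain ⟨q, hq⟩ := Infinite.exists_notMem_finset T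
    obtain ⟨a, rfl⟩ := QuotientGroup.mk_surjective q
    exact ⟨a, hq⟩
  have hone : ∀ i (a : A i), (a : A i ⧸ S.subgroupOf (A i)) ≠ (1 : A i) → (a : N) ∉ S := by
    intro i a ha haS
    refine ha (QuotientGroup.eq.mpr ?_)
    rw [mul_one]
    exact inv_mem (Subgroup.mem_subgroupOf.mpr haS)
  classical
  obtain ⟨a, ha⟩ := hne true {((1 : A true) : A true ⧸ S.subgroupOf (A true))}
  obtain ⟨b, hb⟩ := hne false {((1 : A false) : A false ⧸ S.subgroupOf (A false))}
  -- Three distinct cosets in `A false` allow `b' = d⁻¹`, so that `b' * b` avoids `S`.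
  obtain ⟨d, hd⟩ := hne false {((1 : A false) : A false ⧸ S.subgroupOf (A false)),
    (b : A false ⧸ S.subgroupOf (A false))}
  simp only [Finset.mem_singleton, Finset.mem_insert, not_or] at ha hb hd
  obtain ⟨F, hF⟩ := exists_injective_freeGroup_bool h hinj a.2 (hone _ a ha) b.2 (hone _ b hb)
    (inv_mem d.2) (fun hdS => hone _ d hd.1 (S.inv_mem_iff.mp hdS))
    (fun hS => hd.2 (QuotientGroup.eq.mpr (Subgroup.mem_subgroupOf.mpr hS)))
  exact hasNonabelianFreeSubgroup_of_injective F hF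

end PingPong

/-! ### Infinite index, infinite generation, and existence of characters. -/

section Main

variable {G : Type u} [Group G]

/-- A finite subset of a group is contained in some term of an increasing exhaustion. -/
theorem exists_le_of_finite_subset {N : Type*} [Group N] {T : ℝ → Subgroup N} (hT : Monotone T)
    (hall : ∀ n, ∃ c, n ∈ T c) {s : Set N} (hs : s.Finite) (c₀ : ℝ) :
    ∃ c, c₀ ≤ c ∧ s ⊆ T c := by
  choose b hb using hall
  obtain ⟨B, hB⟩ := (hs.image b).bddAbove
  exact ⟨max c₀ B, le_max_left _ _, fun n hn =>
    hT ((hB ⟨n, hn, rfl⟩).trans (le_max_right _ _)) (hb n)⟩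

theorem exists_le_of_fg {N : Type*} [Group N] {T : ℝ → Subgroup N} (hT : Monotone T)
    (hall : ∀ n, ∃ c, n ∈ T c) {A : Subgroup N} (hA : A.FG) (c₀ : ℝ) :
    ∃ c, c₀ ≤ c ∧ A ≤ T c := by
  obtain ⟨s, rfl⟩ := hA
  obtain ⟨c, hc, hsc⟩ := exists_le_of_finite_subset hT hall s.finite_toSet c₀
  exact ⟨c, hc, (Subgroup.closure_le _).mpr hsc⟩

/-- Finitely many coset representatives are swallowed by one term of the exhaustion, which already
contains `S`. -/
theorem exists_le_of_index_ne_zero {N : Type*} [Group N] {T : ℝ → Subgroup N} (hT : Monotone T)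
    (hall : ∀ n, ∃ c, n ∈ T c) {S A : Subgroup N} (hA : (S.subgroupOf A).index ≠ 0) {c₀ : ℝ}
    (hS : S ≤ T c₀) : ∃ c, c₀ ≤ c ∧ A ≤ T c := by
  have : Finite (A ⧸ S.subgroupOf A) := by
    by_contra hcon
    exact hA (Subgroup.index_eq_zero_iff_infinite.mpr (not_finite_iff_infinite.mp hcon))
  obtain ⟨c, hc, hsc⟩ := exists_le_of_finite_subset hT hall
    (Set.finite_range fun q : A ⧸ S.subgroupOf A => (q.out : N)) c₀
  refine ⟨c, hc, fun x hx => ?_⟩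
  have h1 : (((⟨x, hx⟩ : A) : A ⧸ S.subgroupOf A).out : A)⁻¹ * ⟨x, hx⟩ ∈ S.subgroupOf A :=
    QuotientGroup.eq.mp (QuotientGroup.out_eq' _)
  have h2 := (T c).mul_mem (hsc ⟨((⟨x, hx⟩ : A) : A ⧸ S.subgroupOf A), rfl⟩)
    (hT hc (hS (Subgroup.mem_subgroupOf.mp h1)))
  simpa using h2

variable {Y : Type*} {y : Y → G} (hy : Subgroup.closure (Set.range y) = ⊤)
  {X : Type v} {η : X → G} (hη : IsFiniteGeneratingSystem η)

include hy in
theorem exists_mem_halfSubgroup (χ : Character G) (i : Bool) (n : characterKer χ) :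
    ∃ c, n ∈ halfSubgroup y χ c i := by
  obtain ⟨M, hM, hMc⟩ := exists_heightConnected_mul hy χ (n : G)
  have h1 := hMc 1
  rw [char_one, one_mul, zero_sub, zero_add] at h1
  exact ⟨M, h1.mono (Icc_subset_half M i)⟩

theorem monotone_halfSubgroup (y : Y → G) (χ : Character G) (i : Bool) :
    Monotone fun c => halfSubgroup y χ c i := by
  intro c d hcd
  refine heightSubgroup_mono y χ ?_
  cases i
  · exact Set.Iic_subset_Iic.mpr hcd
  · exact Set.Ici_subset_Ici.mpr (neg_le_neg hcd)

-- The lower half is the upper half for `-χ`, which is why both non-connectivity hypotheses are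
-- needed to treat both values of `i`.
include hy hη in
theorem not_halfSubgroup_le [Finite Y] {χ : Character G} (hχ : χ ≠ 0)
    (h₁ : ¬ (halfCayleyGraph η χ).Connected) (h₂ : ¬ (halfCayleyGraph η (-χ)).Connected)
    {c c' : ℝ} (hc : 0 ≤ c) (hc' : 0 ≤ c') (i : Bool) :
    ¬ halfSubgroup y χ c i ≤ halfSubgroup y χ c' (!i) := by
  intro hle
  cases i
  · obtain ⟨n, hn, hup, hlow⟩ := exists_heightConnected_Ici_not_Iic hy hη (neg_ne_zero.mpr hχ)
      (by rwa [neg_neg]) hc hc'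
    rw [AddMonoidHom.neg_apply, neg_eq_zero] at hn
    have h3 := hup.neg (J := Set.Iic c) fun t ht => by
      rw [Set.mem_Ici] at ht; rw [Set.mem_Iic]; linarith
    rw [neg_neg] at h3
    have h4 : HeightConnected y χ (Set.Ici (-c')) 1 n :=
      hle (show (⟨n, hn⟩ : characterKer χ) ∈ halfSubgroup y χ c false from h3)
    exact hlow (h4.neg fun t ht => by rw [Set.mem_Ici] at ht; rw [Set.mem_Iic]; linarith)
  · obtain ⟨n, hn, hup, hlow⟩ := exists_heightConnected_Ici_not_Iic hy hη hχ h₂ hc hc'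
    exact hlow (hle (show (⟨n, hn⟩ : characterKer χ) ∈ halfSubgroup y χ c true from hup))

include hη in
/-- If neither `χ` nor `-χ` represents a point of `Σ¹`, then the kernel of `χ` is a free product
of infinitely generated groups amalgamated along a subgroup of infinite index in both. -/
theorem exists_amalgam_of_not_connected [Group.IsFinitelyPresented G] {χ : Character G}
    (hχ : χ ≠ 0) (h₁ : ¬ (halfCayleyGraph η χ).Connected)
    (h₂ : ¬ (halfCayleyGraph η (-χ)).Connected) :
    ∃ (S : Subgroup (characterKer χ)) (A : Bool → Subgroup (characterKer χ)) (h : ∀ i, S ≤ A i),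
      Function.Bijective (amalgamMap S A h) ∧
      ∀ i, (S.subgroupOf (A i)).index = 0 ∧ ¬ (A i).FG := by
  obtain ⟨n, f, hf, R, hRfin, hR⟩ := Group.IsFinitelyPresented.out (G := G)
  choose M hM hMc using exists_heightConnected_mul (FreeGroup.closure_range_of (Fin n))
    (χ.comp (MonoidHom.toAdditive f))
  obtain ⟨B, hB⟩ := (hRfin.image M).bddAbove
  obtain ⟨B', hB'⟩ := (Set.finite_range fun i => |χ (.ofMul (f (.of i)))|).bddAbove
  -- `B` bounds the excursions of the finitely many relators, `B'` the heights of the generators.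
  set c := max (max B B') 0
  have hc0 : 0 ≤ c := le_max_right _ _
  have hBc : B ≤ c := (le_max_left _ _).trans (le_max_left _ _)
  have hbij := halfAmalgamMap_bijective hf hR χ hc0
    (fun i => (hB' ⟨i, rfl⟩).trans ((le_max_right _ _).trans (le_max_left _ _)))
    (fun r hr u => (hMc r u).mono (Set.Icc_subset_Icc
      (sub_le_sub_left ((hB ⟨r, hr, rfl⟩).trans hBc) _)
      (by simpa using (hB ⟨r, hr, rfl⟩).trans hBc)))
  set y := f ∘ FreeGroup.of
  have hy : Subgroup.closure (Set.range y) = ⊤ := by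
    rw [Set.range_comp, ← MonoidHom.map_closure, FreeGroup.closure_range_of,
      ← MonoidHom.range_eq_map, MonoidHom.range_eq_top.mpr hf]
  refine ⟨_, _, _, hbij, fun i => ⟨?_, fun hfg => ?_⟩⟩
  · by_contra hindex
    obtain ⟨c', hc', hle⟩ := exists_le_of_index_ne_zero (monotone_halfSubgroup y χ (!i))
      (exists_mem_halfSubgroup hy χ (!i)) hindex (strip_le_halfSubgroup y χ c (!i))
    exact not_halfSubgroup_le hy hη hχ h₁ h₂ hc0 (hc0.trans hc') i hle
  · obtain ⟨c', hc', hle⟩ := exists_le_of_fg (monotone_halfSubgroup y χ (!i))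
      (exists_mem_halfSubgroup hy χ (!i)) hfg 0
    exact not_halfSubgroup_le hy hη hχ h₁ h₂ hc0 hc' i hle

/-- A finitely generated group with infinite abelianization has a non-zero character. -/
theorem exists_character_ne_zero [Group.FG G] [Infinite (Abelianization G)] :
    ∃ χ : Character G, χ ≠ 0 := by
  have : Group.FG (Abelianization G) := QuotientGroup.fg _
  obtain ⟨n, ι, _, p, hp, e, ⟨φ⟩⟩ :=
    AddCommGroup.equiv_free_prod_directSum_zmod (Additive (Abelianization G))
  rcases n with - | n
  -- Rank zero would leave only the finite torsion part; in positive rank a coordinate of the free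
  -- part gives the character.
  · exfalso
    have : ∀ i, NeZero (p i ^ e i) := fun i => ⟨pow_ne_zero _ (hp i).ne_zero⟩
    classical
    have : Finite (DirectSum ι fun i => ZMod (p i ^ e i)) :=
      Finite.of_equiv _ (DirectSum.addEquivProd _).symm.toEquiv
    have : Finite (Additive (Abelianization G)) := Finite.of_equiv _ φ.symm.toEquiv
    have : Finite (Abelianization G) := Finite.of_equiv _ Additive.toMul
    exact not_finite (Abelianization G)
  · let ψ : Additive (Abelianization G) →+ ℝ :=
      (Int.castAddHom ℝ).comp ((Finsupp.applyAddHom (0 : Fin (n + 1))).comp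
        ((AddMonoidHom.fst _ _).comp φ.toAddMonoidHom))
    refine ⟨ψ.comp (MonoidHom.toAdditive Abelianization.of), fun h0 => ?_⟩
    obtain ⟨a, ha⟩ := φ.surjective (Finsupp.single 0 1, 0)
    obtain ⟨g, hg⟩ := QuotientGroup.mk_surjective a.toMul
    have h1 : ψ a = 0 := by
      have := DFunLike.congr_fun h0 (Additive.ofMul g)
      change ψ (Additive.ofMul (Abelianization.of g)) = 0 at this
      rwa [show Additive.ofMul (Abelianization.of g) = a from congrArg Additive.ofMul hg] at this
    have h2 : ψ a = 1 := by
      change ((((φ a).1 0 : ℤ)) : ℝ) = 1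
      rw [ha]
      simp
    rw [h2] at h1
    exact one_ne_zero h1

end Main

end SigmaInvariant

theorem theoremA5p1 {G : Type u} [Group G] [Group.IsFinitelyPresented G]
    {X : Type v} (η : X → G) (hη : SigmaInvariant.IsFiniteGeneratingSystem η) :
    (∀ (χ : SigmaInvariant.Character G) (hχ : χ ≠ 0),
      SigmaInvariant.spherePoint χ hχ ∉ SigmaInvariant.sigmaOne η →
      -SigmaInvariant.spherePoint χ hχ ∉ SigmaInvariant.sigmaOne η →
      (∃ S0 Sm Sp : Subgroup (SigmaInvariant.characterKer χ),
        SigmaInvariant.IsFreeProductWithAmalgamation S0 Sm Sp ∧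
        (S0.subgroupOf Sm).index = 0 ∧ (S0.subgroupOf Sp).index = 0 ∧
        ¬ Sm.FG ∧ ¬ Sp.FG) ∧
      SigmaInvariant.HasNonabelianFreeSubgroup (SigmaInvariant.characterKer χ)) ∧
    (¬ SigmaInvariant.HasNonabelianFreeSubgroup G →
      SigmaInvariant.sigmaOne η ∪ (fun p => -p) '' SigmaInvariant.sigmaOne η = Set.univ ∧
      (Infinite (Abelianization G) → (SigmaInvariant.sigmaOne η).Nonempty)) := by
  open SigmaInvariant in
  have h1 : ∀ (χ : Character G) (hχ : χ ≠ 0), spherePoint χ hχ ∉ sigmaOne η →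
      -spherePoint χ hχ ∉ sigmaOne η →
      (∃ S0 Sm Sp : Subgroup (characterKer χ), IsFreeProductWithAmalgamation S0 Sm Sp ∧
        (S0.subgroupOf Sm).index = 0 ∧ (S0.subgroupOf Sp).index = 0 ∧ ¬ Sm.FG ∧ ¬ Sp.FG) ∧
      HasNonabelianFreeSubgroup (characterKer χ) := by
    intro χ hχ hp hn
    rw [spherePoint_mem_sigmaOne] at hp
    rw [neg_rayOfNeZero, spherePoint_mem_sigmaOne] at hn
    obtain ⟨S, A, h, hbij, hA⟩ := exists_amalgam_of_not_connected hη hχ hp hn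
    refine ⟨⟨S, A false, A true, ?_, (hA false).1, (hA true).1, (hA false).2, (hA true).2⟩,
      hasNonabelianFreeSubgroup_of_amalgam h hbij.1 fun i => (hA i).1⟩
    -- The family written with `cond` equals `A` only after a case split on the index, so
    -- bijectivity is transported along an equality of families.
    have hcond : ∀ A' : Bool → Subgroup (characterKer χ), A' = A →
        ∃ h' : ∀ i, S ≤ A' i, Function.Bijective (amalgamMap S A' h') := by
      rintro _ rfl
      exact ⟨h, hbij⟩
    exact hcond _ (funext fun i => by cases i <;> rfl)
  refine ⟨h1, fun hfree => ?_⟩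
  have hcover : SigmaInvariant.sigmaOne η ∪ (fun p => -p) '' SigmaInvariant.sigmaOne η =
      Set.univ := by
    refine Set.eq_univ_of_forall fun p => ?_
    by_contra hcon
    rw [Set.mem_union, not_or] at hcon
    induction p using Module.Ray.ind with
    | h χ hχ =>
      refine hfree (SigmaInvariant.hasNonabelianFreeSubgroup_of_injective_hom
        (SigmaInvariant.characterKer χ).subtype (Subgroup.subtype_injective _)
        (h1 χ hχ hcon.1 fun hneg => hcon.2 ⟨_, hneg, neg_neg (SigmaInvariant.spherePoint χ hχ)⟩).2)
  refine ⟨hcover, fun hinf => ?_⟩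
  have hfg : Group.FG G := by
    have := hη.finite
    exact Group.fg_iff.mpr ⟨Set.range η, hη.generates, Set.finite_range η⟩
  obtain ⟨χ, hχ⟩ := SigmaInvariant.exists_character_ne_zero (G := G)
  rcases hcover.ge (Set.mem_univ (SigmaInvariant.spherePoint χ hχ)) with h | ⟨q, hq, -⟩
  exacts [⟨_, h⟩, ⟨q, hq⟩]
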